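/- Let $\mathbf n=(n_1,n_2,n_3)\in\mathbb R[u,v]^3$ be a polynomial vector field of degree $k=\max_i\deg n_i$ with $\gcd(n_1,n_2,n_3)=1$, and let $\mathbf N=(N_1,N_2,N_3)$, $N_i=w^k n_i(u/w,v/w)\in R=\mathbb C[u,v,w]$, be its homogenization. Put $\mathrm{Syz}(\mathbf N)=\{\mathbf Q\in R^3 : \sum_i Q_iN_i=0\}$ and let $\mathrm{HF}(\mathrm{Syz}(\mathbf N),\ell)$ be the complex dimension of the space of those $\mathbf Q\in\mathrm{Syz}(\mathbf N)$ whose components are all homogeneous of degree $\ell$. Binomial coefficients $\binom m2$ are understood to be $0$ for $m<2$. A base point of $\mathbf N$ is a common zero of $N_1,N_2,N_3$ in $\mathbb P^2_{\mathbb C}$. A base point of $\mathbf n$ is either a common zero of $n_1,n_2,n_3$ in $\mathbb C^2$, or (a base point at infinity) a common zero in $\mathbb P^1_{\mathbb C}$ of the parts of $n_1,n_2,n_3$ of degree $k$. Then: 1. For every integer $\ell\ge 0$, $$\mathrm{HF}(\mathrm{Syz}(\mathbf N),\ell)\ \ge\ 3\binom{\ell-k+2}{2}-\binom{\ell-2k+2}{2}.$$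 Equality holds for all $\ell\ge 0$ if and only if $\mathbf N$ has no base points. Moreover, for each single $\ell\ge\max(0,2k-2)$, equality holds for this $\ell$ if and only if $\mathbf N$ has no base points. 2. $\mathbf N$ has no base points if and only if $\mathbf n$ has none. For every $\ell\ge 0$, $\mathrm{HF}(\mathrm{Syz}(\mathbf N),\ell)$ is the real dimension of the space of fields $\mathbf q\in\mathbb R[u,v]^3$ of degree at most $\ell$ with $\mathbf q\cdot\mathbf n\equiv 0$. 3. Regard $\mathbf q\cdot\mathbf n\equiv 0$, for $\mathbf q$ of degree at most $\ell$, as a system of $\binom{k+\ell+2}{2}$ homogeneous linear equations in the $3\binom{\ell+2}{2}$ coefficients of $\mathbf q$, and say that it has full rank if its rank equals the number of equations. If it has full rank for some $\ell\ge 0$, then $\mathbf n$ has no base points; for every $\ell\ge\max(0,2k-2)$, it has full rank if and only if $\mathbf n$ has no base points. 4. If $\mathbf n$ has no base points and $\ell\ge\max(0,2k-2)$, then the space of fields of degree at most $\ell$ orthogonal to $\mathbf n$ has real dimension $$3\binom{\ell+2}{2}-\binom{k+\ell+2}{2}.$$ -/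

import Mathlib

open MvPolynomial

/-- The syzygy module of a triple `f` over a commutative ring `R`:
all `q ∈ R³` with `q₁ f₁ + q₂ f₂ + q₃ f₃ = 0`. -/
def syz {R : Type*} [CommRing R] (f : Fin 3 → R) : Submodule R (Fin 3 → R) where
  carrier := {q | ∑ i, q i * f i = 0}
  zero_mem' := by simp
  add_mem' := by
    intro a b ha hb
    simp only [Set.mem_ofPred_eq, Pi.add_apply, add_mul, Finset.sum_add_distrib] at *
    rw [ha, hb, add_zero]
  smul_mem' := by
    intro c a ha
    simp only [Set.mem_ofPred_eq, Pi.smul_apply, smul_eq_mul, mul_assoc, ← Finset.mul_sum] at *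
    rw [ha, mul_zero]

/-- The degree of a polynomial vector field in the variables `u = X 0`, `v = X 1`:
the maximum of the total degrees of its components. -/
noncomputable def fieldDegree (n : Fin 3 → MvPolynomial (Fin 2) ℝ) : ℕ :=
  Finset.univ.sup fun i => (n i).totalDegree

/-- The greatest common divisor of the three components is `1`. -/
def CoprimeComponents (n : Fin 3 → MvPolynomial (Fin 2) ℝ) : Prop :=
  ∀ d : MvPolynomial (Fin 2) ℝ, (∀ i, d ∣ n i) → IsUnit d

/-- The homogenization `w ^ k * p (u / w, v / w)` of a polynomial `p` with `deg p ≤ k`, as an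
element of `ℂ[u, v, w]` with `u = X 0`, `v = X 1`, `w = X 2`. -/
noncomputable def homogenizeTo (k : ℕ) (p : MvPolynomial (Fin 2) ℝ) : MvPolynomial (Fin 3) ℂ :=
  ∑ m ∈ p.support, C ((p.coeff m : ℝ) : ℂ) * (X 0 ^ m 0 * X 1 ^ m 1 * X 2 ^ (k - (m 0 + m 1)))

/-- The homogenization of a vector field: all components are homogenized to the same degree,
the degree of the field. -/
noncomputable def homogenizeField (n : Fin 3 → MvPolynomial (Fin 2) ℝ) :
    Fin 3 → MvPolynomial (Fin 3) ℂ :=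
  fun i => homogenizeTo (fieldDegree n) (n i)

/-- The degree `l` piece of the graded module `Syz(N) ⊆ ℂ[u, v, w]³`: the syzygies all of whose
components are homogeneous of degree `l`. -/
noncomputable def syzPiece (N : Fin 3 → MvPolynomial (Fin 3) ℂ) (l : ℕ) :
    Submodule ℂ (Fin 3 → MvPolynomial (Fin 3) ℂ) :=
  (syz N).restrictScalars ℂ ⊓ Submodule.pi Set.univ fun _ => homogeneousSubmodule (Fin 3) ℂ l

/-- The Hilbert function of `Syz(N)`. -/
noncomputable def hilbertSyz (N : Fin 3 → MvPolynomial (Fin 3) ℂ) (l : ℕ) : ℕ :=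
  Module.finrank ℂ (syzPiece N l)

/-- A homogeneous field has no base point in the complex projective plane (the point is given by
its homogeneous coordinates). -/
def HomBasepointFree (N : Fin 3 → MvPolynomial (Fin 3) ℂ) : Prop :=
  ¬ ∃ x : Fin 3 → ℂ, x ≠ 0 ∧ ∀ i, eval x (N i) = 0

/-- An affine field of degree `k` has no base point over `ℂ`, neither a finite one (a common zero
of the components in `ℂ²`) nor one at infinity (a nontrivial common zero of the terms of
degree `k`). -/
def BasepointFree (n : Fin 3 → MvPolynomial (Fin 2) ℝ) : Prop :=
  (¬ ∃ x : Fin 2 → ℂ, ∀ i, aeval x (n i) = 0) ∧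
  ¬ ∃ x : Fin 2 → ℂ, x ≠ 0 ∧ ∀ i, aeval x (homogeneousComponent (fieldDegree n) (n i)) = 0

/-- The real vector space of fields of degree at most `l` that are orthogonal to `n`. -/
noncomputable def orthogonalFields (n : Fin 3 → MvPolynomial (Fin 2) ℝ) (l : ℕ) :
    Submodule ℝ (Fin 3 → MvPolynomial (Fin 2) ℝ) :=
  (syz n).restrictScalars ℝ ⊓ Submodule.pi Set.univ fun _ => restrictTotalDegree (Fin 2) ℝ l

/-- The exponents of the monomials in `u, v` of degree at most `d`. -/
def exponents (d : ℕ) : Finset (Fin 2 →₀ ℕ) :=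
  (Finset.range (d + 1)).biUnion fun e => Finset.univ.finsuppAntidiag e

theorem mem_exponents (d : ℕ) (m : Fin 2 →₀ ℕ) : m ∈ exponents d ↔ m 0 + m 1 ≤ d := by
  simp [exponents, Finset.mem_finsuppAntidiag, Fin.sum_univ_two]

/-- The matrix of the linear system `q · n ≡ 0` in the unknown coefficients of a field `q` of
degree at most `l`. There is one equation for each monomial of degree at most `deg n + l`, and one
unknown for each component of `q` and each monomial of degree at most `l`. -/
noncomputable def orthogonalityMatrix (n : Fin 3 → MvPolynomial (Fin 2) ℝ) (l : ℕ) :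
    Matrix (exponents (fieldDegree n + l)) (Fin 3 × exponents l) ℝ :=
  Matrix.of fun e c => coeff e.1 (monomial c.2.1 1 * n c.1)

/-- The system `q · n ≡ 0` for fields of degree at most `l` has full rank: its rank is the number
of its equations. -/
def FullRank (n : Fin 3 → MvPolynomial (Fin 2) ℝ) (l : ℕ) : Prop :=
  (orthogonalityMatrix n l).rank = Fintype.card (exponents (fieldDegree n + l))

/-!
Without base points, the Nullstellensatz gives a triple `e` with `e · n = 1`, so every syzygy `q`
of `n` is a Koszul syzygy `n × (q × e)`. The terms of degree `k` of `n` are then coprime as well,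
and this bounds the degree of the cofactor: if the leading terms of `n × a` cancel, the leading
form of `a` is a multiple of that of `n`, and subtracting a multiple of `n` from `a` lowers its
degree without changing `n × a`. Hence the syzygies of degree at most `l` are exactly the products
`n × a` with `deg a ≤ l - k`, and the kernel of `a ↦ n × a` consists of the multiples of `n`, which
gives the dimension. In general, dividing `n` by its greatest common divisor leaves the syzygies
unchanged and can only increase the dimension of the Koszul syzygies, whence the lower bound.

By rank–nullity, for `l ≥ 2 k - 2` this dimension is attained precisely when the combinations
`q · n` with `deg q ≤ l` fill the polynomials of degree at most `k + l`. In that case `1` is such a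
combination, which excludes affine base points, and so is every `X j ^ (k + l)`, whose leading term
then lies in the ideal of the terms of degree `k`, which excludes base points at infinity.

Setting `w = 1` identifies the graded syzygies of the homogenization with the syzygies of bounded
degree over the larger field, and the rank of the linear system does not change under extension of
the field.
-/

open scoped Matrix

section DegreeFiltration

variable {σ R : Type*} [CommRing R]

/-- The polynomials of total degree less than `m`. The strict inequality makes truncated
subtraction harmless: for `m < k`, there are no nonzero polynomials of degree less than `m - k`. -/
noncomputable def totalDegreeLT (σ R : Type*) [CommRing R] (m : ℕ) :
    Submodule R (MvPolynomial σ R) :=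
  restrictSupport R {e | e.degree < m}

theorem mem_totalDegreeLT {m : ℕ} {p : MvPolynomial σ R} :
    p ∈ totalDegreeLT σ R m ↔ ∀ e, coeff e p ≠ 0 → e.degree < m := by
  simp [totalDegreeLT, mem_restrictSupport_iff, Set.subset_def]

theorem mem_totalDegreeLT_iff {m : ℕ} {p : MvPolynomial σ R} :
    p ∈ totalDegreeLT σ R m ↔ p = 0 ∨ p.totalDegree < m := by
  rw [mem_totalDegreeLT]
  constructor
  · intro h
    refine or_iff_not_imp_left.mpr fun hp => ?_
    obtain ⟨e, he⟩ := MvPolynomial.ne_zero_iff.mp hp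
    exact (Finset.sup_lt_iff (Nat.zero_lt_of_lt (h e he))).mpr fun e he =>
      h e (mem_support_iff.mp he)
  · rintro (rfl | h) e he
    · exact absurd (coeff_zero e) he
    · exact (le_totalDegree (mem_support_iff.mpr he)).trans_lt h

theorem totalDegreeLT_succ (m : ℕ) : totalDegreeLT σ R (m + 1) = restrictTotalDegree σ R m := by
  ext p
  rw [mem_restrictTotalDegree, mem_totalDegreeLT_iff, Nat.lt_succ_iff]
  exact or_iff_right_of_imp fun h => by simp [h]

theorem mem_totalDegreeLT_succ {m : ℕ} {p : MvPolynomial σ R} :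
    p ∈ totalDegreeLT σ R (m + 1) ↔ p.totalDegree ≤ m := by
  rw [totalDegreeLT_succ, mem_restrictTotalDegree]

theorem homogeneousComponent_mem_totalDegreeLT (s : ℕ) (p : MvPolynomial σ R) :
    homogeneousComponent s p ∈ totalDegreeLT σ R (s + 1) :=
  mem_totalDegreeLT_succ.mpr (homogeneousComponent_isHomogeneous s p).totalDegree_le

theorem totalDegreeLT_zero : totalDegreeLT σ R 0 = ⊥ := by
  ext p
  simp [mem_totalDegreeLT_iff]

theorem totalDegreeLT_mono : Monotone (totalDegreeLT σ R) := fun _ _ h =>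
  restrictSupport_mono R fun _ he => he.trans_le h

theorem mul_mem_totalDegreeLT {m k : ℕ} {p q : MvPolynomial σ R}
    (hp : p ∈ totalDegreeLT σ R (m - k)) (hq : q.totalDegree ≤ k) :
    p * q ∈ totalDegreeLT σ R m := by
  rw [mem_totalDegreeLT_iff] at *
  rcases hp with rfl | hp
  · exact Or.inl (zero_mul q)
  · have := totalDegree_mul p q
    omega

theorem mul_mem_totalDegreeLT_of_mem {m k : ℕ} {p q : MvPolynomial σ R}
    (hp : p ∈ totalDegreeLT σ R (m + 1 - k)) (hq : q ∈ totalDegreeLT σ R k) :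
    p * q ∈ totalDegreeLT σ R m := by
  rw [mem_totalDegreeLT_iff] at *
  rcases hp with rfl | hp
  · exact Or.inl (zero_mul q)
  rcases hq with rfl | hq
  · exact Or.inl (mul_zero p)
  · have := totalDegree_mul p q
    omega

theorem mem_totalDegreeLT_of_mul_mem [IsDomain R] {m : ℕ} {p q : MvPolynomial σ R} (hq : q ≠ 0)
    (h : p * q ∈ totalDegreeLT σ R m) : p ∈ totalDegreeLT σ R (m - q.totalDegree) := by
  rw [mem_totalDegreeLT_iff] at *
  refine or_iff_not_imp_left.mpr fun hp => ?_
  have hd := h.resolve_left (mul_ne_zero hp hq)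
  rw [totalDegree_mul_of_isDomain hp hq] at hd
  omega

theorem homogeneousComponent_eq_zero_of_mem_totalDegreeLT {s : ℕ} {p : MvPolynomial σ R}
    (hp : p ∈ totalDegreeLT σ R s) : homogeneousComponent s p = 0 := by
  rcases mem_totalDegreeLT_iff.mp hp with rfl | h
  · exact map_zero _
  · exact homogeneousComponent_eq_zero _ _ h

theorem sub_homogeneousComponent_mem_totalDegreeLT {s : ℕ} {p : MvPolynomial σ R}
    (hp : p ∈ totalDegreeLT σ R (s + 1)) : p - homogeneousComponent s p ∈ totalDegreeLT σ R s := by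
  refine mem_totalDegreeLT.mpr fun e he => ?_
  rw [coeff_sub, coeff_homogeneousComponent] at he
  split_ifs at he with hs
  · exact absurd (sub_self _) he
  · exact lt_of_le_of_ne
      (Nat.lt_succ_iff.mp (mem_totalDegreeLT.mp hp e (by simpa only [sub_zero] using he))) hs

theorem homogeneousComponent_add_mul {a b : ℕ} {p q : MvPolynomial σ R}
    (hp : p ∈ totalDegreeLT σ R (a + 1)) (hq : q.totalDegree ≤ b) :
    homogeneousComponent (a + b) (p * q)
      = homogeneousComponent a p * homogeneousComponent b q := by
  set p' := homogeneousComponent a p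
  set q' := homogeneousComponent b q
  have hp' : p' ∈ totalDegreeLT σ R (a + b + 1 - b) := by
    rw [Nat.add_right_comm, Nat.add_sub_cancel]
    exact homogeneousComponent_mem_totalDegreeLT a p
  have hlow : p' * (q - q') + (p - p') * q ∈ totalDegreeLT σ R (a + b) := by
    refine add_mem (mul_mem_totalDegreeLT_of_mem hp' ?_) (mul_mem_totalDegreeLT ?_ hq)
    · exact sub_homogeneousComponent_mem_totalDegreeLT (mem_totalDegreeLT_succ.mpr hq)
    · rw [Nat.add_sub_cancel]
      exact sub_homogeneousComponent_mem_totalDegreeLT hp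
  rw [show p * q = p' * q' + (p' * (q - q') + (p - p') * q) by ring, map_add,
    homogeneousComponent_eq_zero_of_mem_totalDegreeLT hlow, add_zero,
    homogeneousComponent_eq_self ((homogeneousComponent_isHomogeneous a p).mul
      (homogeneousComponent_isHomogeneous b q))]

end DegreeFiltration

theorem exists_eq_smul_of_cross_eq_zero {R : Type*} [CommRing R] [IsDomain R]
    [UniqueFactorizationMonoid R] {n a : Fin 3 → R} (hn : ∀ d, (∀ i, d ∣ n i) → IsUnit d)
    (h : n ⨯₃ a = 0) : ∃ c : R, a = c • n := by
  classical
  have minors : ∀ i j, n i * a j = n j * a i := by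
    have h0 : n 1 * a 2 = n 2 * a 1 := sub_eq_zero.mp (congrFun h 0)
    have h1 : n 2 * a 0 = n 0 * a 2 := sub_eq_zero.mp (congrFun h 1)
    have h2 : n 0 * a 1 = n 1 * a 0 := sub_eq_zero.mp (congrFun h 2)
    simp only [Fin.forall_fin_succ, Fin.succ_zero_eq_one, Fin.succ_one_eq_two, h0, h1, h2,
      IsEmpty.forall_iff, and_self]
  obtain ⟨i, hi⟩ : ∃ i, n i ≠ 0 := by
    by_contra! h0
    exact not_isUnit_zero (hn 0 fun i => (h0 i).symm.dvd)
  let _ : StrongNormalizationMonoid R := UniqueFactorizationMonoid.strongNormalizationMonoid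
  let _ : NormalizedGCDMonoid R := UniqueFactorizationMonoid.toNormalizedGCDMonoid R
  have unit_gcd : IsUnit (Finset.univ.gcd n) := hn _ fun j => Finset.gcd_dvd (Finset.mem_univ j)
  have dvd_gcd : n i ∣ Finset.univ.gcd fun j => a i * n j :=
    Finset.dvd_gcd fun j _ => ⟨a j, by rw [minors i j, mul_comm]⟩
  rw [(Finset.gcd_mul_left' Finset.univ n (a i)).dvd_iff_dvd_right, unit_gcd.dvd_mul_right]
    at dvd_gcd
  obtain ⟨c, hc⟩ := dvd_gcd
  refine ⟨c, funext fun j => mul_left_cancel₀ hi ?_⟩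
  rw [minors i j, hc, Pi.smul_apply, smul_eq_mul]
  ring

theorem eq_cross_of_dotProduct_eq_one {R : Type*} [CommRing R] {n q e : Fin 3 → R}
    (hq : ∑ i, q i * n i = 0) (he : ∑ i, e i * n i = 1) :
    q = n ⨯₃ (q ⨯₃ e) := by
  have hqn : q ⬝ᵥ n = 0 := hq
  have hne : n ⬝ᵥ e = 1 := (dotProduct_comm n e).trans he
  rw [cross_cross_eq_smul_sub_smul', hqn, hne, one_smul, zero_smul, sub_zero]

theorem finrank_map_add_finrank_inf_ker {K V W : Type*} [Field K] [AddCommGroup V] [Module K V]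
    [AddCommGroup W] [Module K W] (f : V →ₗ[K] W) (U : Submodule K V) [FiniteDimensional K U] :
    Module.finrank K (U.map f) + Module.finrank K ↥(U ⊓ LinearMap.ker f)
      = Module.finrank K U := by
  rw [← (f.domRestrict U).finrank_range_add_finrank_ker, LinearMap.range_domRestrict,
    LinearMap.ker_domRestrict, ← Submodule.map_comap_subtype, Submodule.finrank_map_subtype_eq]

section Fields

variable {σ R : Type*} [CommRing R]

/-- The triples of polynomials of total degree less than `m`. -/
noncomputable def fieldDegreeLT (σ R : Type*) [CommRing R] (m : ℕ) :
    Submodule R (Fin 3 → MvPolynomial σ R) :=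
  Submodule.pi Set.univ fun _ => totalDegreeLT σ R m

/-- The syzygies of degree at most `l` of a triple of polynomials. -/
noncomputable def boundedSyz (n : Fin 3 → MvPolynomial σ R) (l : ℕ) :
    Submodule R (Fin 3 → MvPolynomial σ R) :=
  (syz n).restrictScalars R ⊓ Submodule.pi Set.univ fun _ => restrictTotalDegree σ R l

/-- The Koszul syzygies `n × a` with `a` of degree less than `m`. -/
noncomputable def koszulSyz (n : Fin 3 → MvPolynomial σ R) (m : ℕ) :
    Submodule R (Fin 3 → MvPolynomial σ R) :=
  (fieldDegreeLT σ R m).map ((crossProduct n).restrictScalars R)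

/-- The terms of degree `k` of a triple of polynomials. -/
noncomputable def topForms (k : ℕ) (n : Fin 3 → MvPolynomial σ R) :
    Fin 3 → MvPolynomial σ R :=
  fun i => homogeneousComponent k (n i)

theorem mem_fieldDegreeLT {m : ℕ} {q : Fin 3 → MvPolynomial σ R} :
    q ∈ fieldDegreeLT σ R m ↔ ∀ i, q i ∈ totalDegreeLT σ R m := by
  simp [fieldDegreeLT, Submodule.mem_pi]

theorem fieldDegreeLT_mono : Monotone (fieldDegreeLT σ R) := fun _ _ h _ hq =>
  mem_fieldDegreeLT.mpr fun i => totalDegreeLT_mono h (mem_fieldDegreeLT.mp hq i)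

theorem exists_mem_fieldDegreeLT (q : Fin 3 → MvPolynomial σ R) :
    ∃ m, q ∈ fieldDegreeLT σ R m :=
  ⟨_, mem_fieldDegreeLT.mpr fun i =>
    mem_totalDegreeLT_succ.mpr (Finset.le_sup (f := fun i => (q i).totalDegree)
      (Finset.mem_univ i))⟩

theorem mem_boundedSyz {n q : Fin 3 → MvPolynomial σ R} {l : ℕ} :
    q ∈ boundedSyz n l ↔ ∑ i, q i * n i = 0 ∧ q ∈ fieldDegreeLT σ R (l + 1) := by
  rw [fieldDegreeLT, totalDegreeLT_succ]
  rfl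

theorem cross_mem_fieldDegreeLT {n a : Fin 3 → MvPolynomial σ R} {k m : ℕ}
    (hk : ∀ i, (n i).totalDegree ≤ k) (ha : a ∈ fieldDegreeLT σ R (m - k)) :
    n ⨯₃ a ∈ fieldDegreeLT σ R m := by
  have mem : ∀ i j, n i * a j ∈ totalDegreeLT σ R m := fun i j => by
    rw [mul_comm]
    exact mul_mem_totalDegreeLT (mem_fieldDegreeLT.mp ha j) (hk i)
  rw [mem_fieldDegreeLT, cross_apply, Fin.forall_fin_succ, Fin.forall_fin_two]
  exact ⟨sub_mem (mem _ _) (mem _ _), sub_mem (mem _ _) (mem _ _), sub_mem (mem _ _) (mem _ _)⟩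

theorem koszulSyz_le_boundedSyz {n : Fin 3 → MvPolynomial σ R} {k : ℕ}
    (hk : ∀ i, (n i).totalDegree ≤ k) (l : ℕ) : koszulSyz n (l + 1 - k) ≤ boundedSyz n l := by
  rintro _ ⟨a, ha, rfl⟩
  refine mem_boundedSyz.mpr ⟨?_, cross_mem_fieldDegreeLT hk ha⟩
  exact (dotProduct_comm _ _).trans (dot_self_cross n a)

theorem topForms_cross {n a : Fin 3 → MvPolynomial σ R} {k s : ℕ}
    (hk : ∀ i, (n i).totalDegree ≤ k) (ha : a ∈ fieldDegreeLT σ R (s + 1)) :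
    topForms (s + k) (n ⨯₃ a) = topForms k n ⨯₃ topForms s a := by
  have top_mul : ∀ i j, homogeneousComponent (s + k) (n i * a j)
      = homogeneousComponent k (n i) * homogeneousComponent s (a j) := fun i j => by
    rw [mul_comm, homogeneousComponent_add_mul (mem_fieldDegreeLT.mp ha j) (hk i), mul_comm]
  ext1 i
  fin_cases i <;> simp only [topForms, cross_apply, Fin.zero_eta, Fin.mk_one, Fin.reduceFinMk,
    Matrix.cons_val, map_sub, top_mul]

theorem exists_topForms_ne_zero [Nontrivial R] {n : Fin 3 → MvPolynomial σ R} {k : ℕ}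
    (h : ∀ d, (∀ i, d ∣ topForms k n i) → IsUnit d) :
    ∃ i, topForms k n i ≠ 0 := by
  by_contra! h0
  exact not_isUnit_zero (h 0 fun i => (h0 i).symm.dvd)

end Fields

section Lowering

variable {σ R : Type*} [CommRing R] [IsDomain R] [UniqueFactorizationMonoid R]
  {n : Fin 3 → MvPolynomial σ R} {k : ℕ}

theorem exists_lower_degree_cross_eq (hk : ∀ i, (n i).totalDegree ≤ k)
    (htop : ∀ d, (∀ i, d ∣ topForms k n i) → IsUnit d) {s : ℕ} {a : Fin 3 → MvPolynomial σ R}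
    (ha : a ∈ fieldDegreeLT σ R (s + 1)) (h : n ⨯₃ a ∈ fieldDegreeLT σ R (s + k)) :
    ∃ b ∈ fieldDegreeLT σ R s, n ⨯₃ b = n ⨯₃ a := by
  obtain ⟨c, hc⟩ : ∃ c, topForms s a = c • topForms k n := by
    refine exists_eq_smul_of_cross_eq_zero htop ?_
    rw [← topForms_cross hk ha]
    exact funext fun i =>
      homogeneousComponent_eq_zero_of_mem_totalDegreeLT (mem_fieldDegreeLT.mp h i)
  have top_eq : ∀ j, homogeneousComponent s (a j) = c * homogeneousComponent k (n j) := congrFun hc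
  obtain ⟨i, hi⟩ := exists_topForms_ne_zero htop
  have c_mem : c ∈ totalDegreeLT σ R (s + 1 - k) := by
    rw [← (homogeneousComponent_isHomogeneous k (n i)).totalDegree hi]
    exact mem_totalDegreeLT_of_mul_mem hi
      (top_eq i ▸ homogeneousComponent_mem_totalDegreeLT s (a i))
  refine ⟨a - c • n, mem_fieldDegreeLT.mpr fun j => ?_, ?_⟩
  · have split : (a - c • n) j = (a j - homogeneousComponent s (a j))
        - c * (n j - homogeneousComponent k (n j)) := by
      rw [Pi.sub_apply, Pi.smul_apply, smul_eq_mul, top_eq]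
      ring
    rw [split]
    refine sub_mem (sub_homogeneousComponent_mem_totalDegreeLT (mem_fieldDegreeLT.mp ha j))
      (mul_mem_totalDegreeLT_of_mem c_mem ?_)
    exact sub_homogeneousComponent_mem_totalDegreeLT (mem_totalDegreeLT_succ.mpr (hk j))
  · rw [map_sub, map_smul, cross_self, smul_zero, sub_zero]

theorem cross_mem_koszulSyz (hk : ∀ i, (n i).totalDegree ≤ k)
    (htop : ∀ d, (∀ i, d ∣ topForms k n i) → IsUnit d) {l m : ℕ} {a : Fin 3 → MvPolynomial σ R}
    (ha : a ∈ fieldDegreeLT σ R m) (h : n ⨯₃ a ∈ fieldDegreeLT σ R (l + 1)) :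
    n ⨯₃ a ∈ koszulSyz n (l + 1 - k) := by
  induction m generalizing a with
  | zero => exact ⟨a, fieldDegreeLT_mono (Nat.zero_le _) ha, rfl⟩
  | succ s ih =>
    rcases Nat.lt_or_ge s (l + 1 - k) with hs | hs
    · exact ⟨a, fieldDegreeLT_mono hs ha, rfl⟩
    · obtain ⟨b, hb, hba⟩ := exists_lower_degree_cross_eq hk htop ha
        (fieldDegreeLT_mono (by omega) h)
      rw [← hba] at h ⊢
      exact ih hb h

theorem boundedSyz_eq_koszulSyz (hk : ∀ i, (n i).totalDegree ≤ k)
    (hspan : Ideal.span (Set.range n) = ⊤)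
    (htop : ∀ d, (∀ i, d ∣ topForms k n i) → IsUnit d) (l : ℕ) :
    boundedSyz n l = koszulSyz n (l + 1 - k) := by
  refine le_antisymm (fun q hq => ?_) (koszulSyz_le_boundedSyz hk l)
  obtain ⟨hq0, hq⟩ := mem_boundedSyz.mp hq
  obtain ⟨e, he⟩ := Ideal.mem_span_range_iff_exists_fun.mp ((Ideal.eq_top_iff_one _).mp hspan)
  have hcross := eq_cross_of_dotProduct_eq_one hq0 he
  obtain ⟨m, hm⟩ := exists_mem_fieldDegreeLT (q ⨯₃ e)
  rw [hcross] at hq ⊢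
  exact cross_mem_koszulSyz hk htop hm hq

end Lowering

section BasePoints

variable {ι σ K : Type*} [Field K]

/-- The polynomials `f i` have no common zero in the projective space over `L`, whose points are
given by homogeneous coordinates. -/
def NoProjectiveZero (L : Type*) [Field L] [Algebra K L] (f : ι → MvPolynomial σ K) : Prop :=
  ¬ ∃ x : σ → L, x ≠ 0 ∧ ∀ i, aeval x (f i) = 0

/-- A triple of polynomials of degree at most `k` has no base point over `L`, neither an affine one
nor one at infinity, which is a projective zero of the terms of degree `k`. -/
def NoBasePoint (L : Type*) [Field L] [Algebra K L] (k : ℕ) (n : Fin 3 → MvPolynomial σ K) : Prop :=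
  (¬ ∃ x : σ → L, ∀ i, aeval x (n i) = 0) ∧ NoProjectiveZero L (topForms k n)

variable {L : Type*} [Field L] [Algebra K L]

theorem aeval_eq_zero_of_mem_span {f : ι → MvPolynomial σ K} {x : σ → L}
    (hx : ∀ i, aeval x (f i) = 0) {p : MvPolynomial σ K} (hp : p ∈ Ideal.span (Set.range f)) :
    aeval x p = 0 := by
  have : Ideal.span (Set.range f) ≤ RingHom.ker (aeval x) :=
    Ideal.span_le.mpr (Set.range_subset_iff.mpr hx)
  exact this hp

theorem exists_pow_mem_span_of_aeval_eq_zero [IsAlgClosed L] [Finite σ]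
    {f : ι → MvPolynomial σ K} {p : MvPolynomial σ K}
    (h : ∀ x : σ → L, (∀ i, aeval x (f i) = 0) → aeval x p = 0) :
    ∃ s : ℕ, p ^ s ∈ Ideal.span (Set.range f) := by
  suffices p ∈ (Ideal.span (Set.range f)).radical from this
  rw [← vanishingIdeal_zeroLocus_eq_radical (K := L), zeroLocus_span]
  exact fun x hx => h x fun i => hx _ ⟨i, rfl⟩

theorem span_eq_top_iff_no_zero [IsAlgClosed L] [Finite σ] {f : ι → MvPolynomial σ K} :
    Ideal.span (Set.range f) = ⊤ ↔ ¬ ∃ x : σ → L, ∀ i, aeval x (f i) = 0 := by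
  rw [Ideal.eq_top_iff_one]
  refine ⟨fun h1 ⟨x, hx⟩ => ?_, fun h => ?_⟩
  · simpa using aeval_eq_zero_of_mem_span hx h1
  · obtain ⟨s, hs⟩ := exists_pow_mem_span_of_aeval_eq_zero (p := 1) fun x hx => (h ⟨x, hx⟩).elim
    rwa [one_pow] at hs

theorem noProjectiveZero_iff_exists_X_pow_mem_span [IsAlgClosed L] [Finite σ]
    {f : ι → MvPolynomial σ K} :
    NoProjectiveZero L f ↔ ∀ j, ∃ s : ℕ, X j ^ s ∈ Ideal.span (Set.range f) := by
  refine ⟨fun h j => exists_pow_mem_span_of_aeval_eq_zero (L := L) fun x hx => ?_,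
    fun h ⟨x, hx0, hx⟩ => ?_⟩
  · have hx0 : x = 0 := not_not.mp fun hx0 => h ⟨x, hx0, hx⟩
    rw [aeval_X, hx0, Pi.zero_apply]
  · refine hx0 (funext fun j => ?_)
    obtain ⟨s, hs⟩ := h j
    have := aeval_eq_zero_of_mem_span hx hs
    rw [map_pow, aeval_X] at this
    exact eq_zero_of_pow_eq_zero this

theorem dvd_of_mem_span {R : Type*} [CommRing R] {f : ι → R} {d p : R} (hd : ∀ i, d ∣ f i)
    (hp : p ∈ Ideal.span (Set.range f)) : d ∣ p := by
  have : Ideal.span (Set.range f) ≤ Ideal.span {d} :=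
    Ideal.span_le.mpr (Set.range_subset_iff.mpr fun i => Ideal.mem_span_singleton.mpr (hd i))
  exact Ideal.mem_span_singleton.mp (this hp)

theorem isUnit_of_dvd_X_pow {i j : σ} (hij : i ≠ j) {d : MvPolynomial σ K} {s t : ℕ}
    (hi : d ∣ X i ^ s) (hj : d ∣ X j ^ t) : IsUnit d := by
  have irreducible : Irreducible (X i : MvPolynomial σ K) := X_prime.irreducible
  have relPrime : IsRelPrime (X i : MvPolynomial σ K) (X j) :=
    irreducible.isRelPrime_iff_not_dvd.mpr fun h => hij (X_dvd_X.mp h)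
  exact relPrime.pow hi hj

theorem NoProjectiveZero.isUnit_of_dvd [IsAlgClosed L] [Finite σ] [Nontrivial σ]
    {f : ι → MvPolynomial σ K} (h : NoProjectiveZero L f) {d : MvPolynomial σ K}
    (hd : ∀ i, d ∣ f i) : IsUnit d := by
  have dvd_X_pow : ∀ j : σ, ∃ s : ℕ, d ∣ X j ^ s := fun j =>
    ((noProjectiveZero_iff_exists_X_pow_mem_span (L := L)).mp h j).imp fun _ => dvd_of_mem_span hd
  obtain ⟨i, j, hij⟩ := exists_pair_ne σ
  obtain ⟨s, hs⟩ := dvd_X_pow i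
  obtain ⟨t, ht⟩ := dvd_X_pow j
  exact isUnit_of_dvd_X_pow hij hs ht

theorem NoBasePoint.isUnit_of_dvd [IsAlgClosed L] [Finite σ] {k : ℕ}
    {n : Fin 3 → MvPolynomial σ K} (h : NoBasePoint L k n) {d : MvPolynomial σ K}
    (hd : ∀ i, d ∣ n i) : IsUnit d :=
  isUnit_of_dvd_one
    (dvd_of_mem_span hd ((Ideal.eq_top_iff_one _).mp (span_eq_top_iff_no_zero.mpr h.1)))

theorem NoBasePoint.boundedSyz_eq_koszulSyz [IsAlgClosed L] [Finite σ] [Nontrivial σ] {k : ℕ}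
    {n : Fin 3 → MvPolynomial σ K} (hk : ∀ i, (n i).totalDegree ≤ k) (h : NoBasePoint L k n)
    (l : ℕ) : boundedSyz n l = koszulSyz n (l + 1 - k) :=
  _root_.boundedSyz_eq_koszulSyz hk (span_eq_top_iff_no_zero.mpr h.1)
    (fun _ => h.2.isUnit_of_dvd) l

end BasePoints

section Dimension

variable {σ K : Type*} [Field K]

theorem fieldDegreeLT_eq_range (m : ℕ) :
    fieldDegreeLT σ K m = LinearMap.range ((totalDegreeLT σ K m).subtype.compLeft (Fin 3)) := by
  rw [LinearMap.range_compLeft, Submodule.range_subtype, fieldDegreeLT]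

instance [Finite σ] (m : ℕ) : FiniteDimensional K (totalDegreeLT σ K m) := by
  have : FiniteDimensional K (totalDegreeLT σ K (m + 1)) := by
    rw [totalDegreeLT_succ]
    infer_instance
  exact Submodule.finiteDimensional_of_le (totalDegreeLT_mono m.le_succ)

instance [Finite σ] (m : ℕ) : FiniteDimensional K (fieldDegreeLT σ K m) := by
  rw [fieldDegreeLT_eq_range]
  infer_instance

theorem boundedSyz_le_fieldDegreeLT (n : Fin 3 → MvPolynomial σ K) (l : ℕ) :
    boundedSyz n l ≤ fieldDegreeLT σ K (l + 1) := fun _ hq => (mem_boundedSyz.mp hq).2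

instance [Finite σ] (n : Fin 3 → MvPolynomial σ K) (l : ℕ) :
    FiniteDimensional K (boundedSyz n l) :=
  Submodule.finiteDimensional_of_le (boundedSyz_le_fieldDegreeLT n l)

theorem card_exponents (d : ℕ) : (exponents d).card = (d + 2).choose 2 := by
  rw [exponents, Finset.card_biUnion]
  · simp only [Finset.card_finsuppAntidiag_nat_eq_choose, Finset.card_univ, Fintype.card_fin]
    induction d with
    | zero => rfl
    | succ d ih =>
      rw [Finset.sum_range_succ, ih, Nat.choose_succ_succ' (d + 2) 1, Nat.choose_one_right,
        show 2 + (d + 1) - 1 = d + 1 + 1 by omega, Nat.choose_succ_self_right, add_comm]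
  · refine fun a _ b _ hab => Finset.disjoint_left.mpr fun e ha hb => hab ?_
    rw [Finset.mem_finsuppAntidiag] at ha hb
    exact ha.1.symm.trans hb.1

theorem totalDegreeLT_succ_eq_restrictSupport_exponents (d : ℕ) :
    totalDegreeLT (Fin 2) K (d + 1) = restrictSupport K (exponents d : Set (Fin 2 →₀ ℕ)) := by
  rw [totalDegreeLT]
  congr
  ext e
  simp [mem_exponents, Finsupp.degree_eq_sum]

theorem finrank_totalDegreeLT (m : ℕ) :
    Module.finrank K (totalDegreeLT (Fin 2) K m) = (m + 1).choose 2 := by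
  cases m with
  | zero => exact totalDegreeLT_zero (σ := Fin 2) (R := K) ▸ finrank_bot K _
  | succ d =>
    rw [totalDegreeLT_succ_eq_restrictSupport_exponents,
      Module.finrank_eq_nat_card_basis (basisRestrictSupport K _), ← card_exponents]
    exact Nat.card_eq_finsetCard _

theorem finrank_fieldDegreeLT (m : ℕ) :
    Module.finrank K (fieldDegreeLT (Fin 2) K m) = 3 * (m + 1).choose 2 := by
  rw [fieldDegreeLT_eq_range, LinearMap.finrank_range_of_inj
    (Subtype.val_injective.comp_left), Module.finrank_pi_fintype]
  simp only [finrank_totalDegreeLT, Finset.sum_const, Finset.card_univ, Fintype.card_fin,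
    smul_eq_mul]

theorem exists_ne_zero_forall_totalDegree_le {n : Fin 3 → MvPolynomial σ K} (hn : n ≠ 0) :
    ∃ i, n i ≠ 0 ∧ ∀ j, (n j).totalDegree ≤ (n i).totalDegree := by
  obtain ⟨i, hi⟩ := Finite.exists_max fun j => (n j).totalDegree
  by_cases h0 : n i = 0
  · obtain ⟨j, hj⟩ := Function.ne_iff.mp hn
    refine ⟨j, hj, fun j' => (hi j').trans ?_⟩
    rw [h0, totalDegree_zero]
    exact Nat.zero_le _
  · exact ⟨i, h0, hi⟩

theorem fieldDegreeLT_inf_ker_crossProduct {n : Fin 3 → MvPolynomial σ K} {i : Fin 3}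
    (hn : ∀ d, (∀ j, d ∣ n j) → IsUnit d) (hi : n i ≠ 0)
    (hmax : ∀ j, (n j).totalDegree ≤ (n i).totalDegree) (m : ℕ) :
    fieldDegreeLT σ K m ⊓ LinearMap.ker ((crossProduct n).restrictScalars K)
      = (totalDegreeLT σ K (m - (n i).totalDegree)).map
        ((LinearMap.toSpanSingleton (MvPolynomial σ K) _ n).restrictScalars K) := by
  refine le_antisymm ?_ ?_
  · rintro a ⟨ha, hker⟩
    obtain ⟨c, rfl⟩ := exists_eq_smul_of_cross_eq_zero hn hker
    exact ⟨c, mem_totalDegreeLT_of_mul_mem hi (mem_fieldDegreeLT.mp ha i), rfl⟩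
  · rintro _ ⟨c, hc, rfl⟩
    refine ⟨mem_fieldDegreeLT.mpr fun j => mul_mem_totalDegreeLT hc (hmax j), ?_⟩
    change n ⨯₃ (c • n) = 0
    rw [map_smul, cross_self, smul_zero]

theorem finrank_koszulSyz_add {n : Fin 3 → MvPolynomial (Fin 2) K} {i : Fin 3}
    (hn : ∀ d, (∀ j, d ∣ n j) → IsUnit d) (hi : n i ≠ 0)
    (hmax : ∀ j, (n j).totalDegree ≤ (n i).totalDegree) (m : ℕ) :
    Module.finrank K (koszulSyz n m) + (m - (n i).totalDegree + 1).choose 2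
      = 3 * (m + 1).choose 2 := by
  have smul_injective : Function.Injective
      ((LinearMap.toSpanSingleton (MvPolynomial (Fin 2) K) _ n).restrictScalars K) :=
    fun _ _ h => mul_right_cancel₀ hi (congrFun h i)
  have := finrank_map_add_finrank_inf_ker ((crossProduct n).restrictScalars K)
    (fieldDegreeLT (Fin 2) K m)
  rwa [fieldDegreeLT_inf_ker_crossProduct hn hi hmax,
    ← (Submodule.equivMapOfInjective _ smul_injective _).finrank_eq, finrank_totalDegreeLT,
    finrank_fieldDegreeLT] at this

/-- The dimension of the space of Koszul syzygies of degree at most `l` of three coprime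
polynomials in two variables of maximal degree `k`. -/
def koszulDim (k l : ℕ) : ℤ :=
  3 * ((l + 2 - k).choose 2 : ℤ) - ((l + 2 - 2 * k).choose 2 : ℤ)

theorem choose_two_sub_add_one (a b : ℕ) : (a - b + 1).choose 2 = (a + 1 - b).choose 2 := by
  rcases Nat.lt_or_ge a b with h | h
  · rw [Nat.sub_eq_zero_of_le h.le, Nat.sub_eq_zero_of_le h]
    rfl
  · rw [Nat.sub_add_comm h]

theorem finrank_koszulSyz {n : Fin 3 → MvPolynomial (Fin 2) K} {i : Fin 3}
    (hn : ∀ d, (∀ j, d ∣ n j) → IsUnit d) (hi : n i ≠ 0)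
    (hmax : ∀ j, (n j).totalDegree ≤ (n i).totalDegree) (l : ℕ) :
    (Module.finrank K (koszulSyz n (l + 1 - (n i).totalDegree)) : ℤ)
      = koszulDim (n i).totalDegree l := by
  have := finrank_koszulSyz_add hn hi hmax (l + 1 - (n i).totalDegree)
  rw [Nat.sub_sub, ← two_mul, choose_two_sub_add_one, choose_two_sub_add_one] at this
  change _ + (l + 2 - _).choose 2 = 3 * (l + 2 - _).choose 2 at this
  rw [koszulDim]
  omega

theorem koszulDim_antitone (l : ℕ) : Antitone fun k => koszulDim k l := by
  refine antitone_nat_of_succ_le fun k => ?_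
  have choose_succ : ∀ x : ℕ, ((x + 1).choose 2 : ℤ) = x.choose 2 + x := fun x => by
    rw [Nat.choose_succ_succ', Nat.choose_one_right]
    push_cast
    ring
  simp only [koszulDim]
  rcases Nat.lt_or_ge l (2 * k) with h | h
  · have low : (l + 2 - 2 * k).choose 2 = 0 := Nat.choose_eq_zero_of_lt (by omega)
    have : (l + 2 - (k + 1)).choose 2 ≤ (l + 2 - k).choose 2 := Nat.choose_le_choose 2 (by omega)
    omega
  · obtain ⟨y, rfl⟩ := Nat.exists_eq_add_of_le h
    rw [show 2 * k + y + 2 - (k + 1) = k + y + 1 by omega,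
      show 2 * k + y + 2 - 2 * (k + 1) = y by omega,
      show 2 * k + y + 2 - k = k + y + 1 + 1 by omega,
      show 2 * k + y + 2 - 2 * k = y + 1 + 1 by omega]
    simp only [choose_succ]
    push_cast
    omega

theorem boundedSyz_smul {n : Fin 3 → MvPolynomial σ K} {d : MvPolynomial σ K} (hd : d ≠ 0)
    (l : ℕ) : boundedSyz (d • n) l = boundedSyz n l := by
  ext q
  have : ∑ i, q i * (d • n) i = d * ∑ i, q i * n i := by
    simp only [Pi.smul_apply, smul_eq_mul, Finset.mul_sum, mul_left_comm]
  rw [mem_boundedSyz, mem_boundedSyz, this, mul_eq_zero_iff_left hd]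

theorem exists_eq_smul_coprime {R : Type*} [CommRing R] [IsDomain R] [UniqueFactorizationMonoid R]
    (n : Fin 3 → R) :
    ∃ (d : R) (n' : Fin 3 → R), n = d • n' ∧ ∀ c, (∀ i, c ∣ n' i) → IsUnit c := by
  classical
  let _ : StrongNormalizationMonoid R := UniqueFactorizationMonoid.strongNormalizationMonoid
  let _ : NormalizedGCDMonoid R := UniqueFactorizationMonoid.toNormalizedGCDMonoid R
  obtain ⟨n', hn', hgcd⟩ := Finset.univ.extract_gcd n Finset.univ_nonempty
  refine ⟨_, n', funext fun i => hn' i (Finset.mem_univ i), fun c hc => isUnit_of_dvd_one ?_⟩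
  rw [← hgcd]
  exact Finset.dvd_gcd fun i _ => hc i

theorem boundedSyz_zero (l : ℕ) :
    boundedSyz (0 : Fin 3 → MvPolynomial σ K) l = fieldDegreeLT σ K (l + 1) := by
  ext q
  simp [mem_boundedSyz]

theorem koszulDim_le_finrank_boundedSyz {n : Fin 3 → MvPolynomial (Fin 2) K} {k : ℕ}
    (hk : ∀ i, (n i).totalDegree ≤ k) (l : ℕ) :
    koszulDim k l ≤ Module.finrank K (boundedSyz n l) := by
  by_cases hn0 : n = 0
  · rw [hn0, boundedSyz_zero, finrank_fieldDegreeLT]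
    refine (koszulDim_antitone l (Nat.zero_le k)).trans ?_
    simp [koszulDim]
  obtain ⟨d, n', rfl, hn'⟩ := exists_eq_smul_coprime n
  have hd : d ≠ 0 := left_ne_zero_of_smul hn0
  obtain ⟨i, hi, hmax⟩ := exists_ne_zero_forall_totalDegree_le (right_ne_zero_of_smul hn0)
  have hik : (n' i).totalDegree ≤ k := by
    have := hk i
    rw [Pi.smul_apply, smul_eq_mul, totalDegree_mul_of_isDomain hd hi] at this
    omega
  calc koszulDim k l ≤ koszulDim (n' i).totalDegree l := koszulDim_antitone l hik
    _ = Module.finrank K (koszulSyz n' (l + 1 - (n' i).totalDegree)) :=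
      (finrank_koszulSyz hn' hi hmax l).symm
    _ ≤ Module.finrank K (boundedSyz n' l) :=
      Nat.cast_le.mpr (Submodule.finrank_mono (koszulSyz_le_boundedSyz hmax l))
    _ = Module.finrank K (boundedSyz (d • n') l) := by rw [boundedSyz_smul hd]

theorem NoBasePoint.finrank_boundedSyz {L : Type*} [Field L] [Algebra K L] [IsAlgClosed L] {k : ℕ}
    {n : Fin 3 → MvPolynomial (Fin 2) K} (hk : ∀ i, (n i).totalDegree ≤ k)
    (h : NoBasePoint L k n) (l : ℕ) :
    (Module.finrank K (boundedSyz n l) : ℤ) = koszulDim k l := by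
  obtain ⟨i, hi⟩ := exists_topForms_ne_zero (n := n) (k := k) fun _ => h.2.isUnit_of_dvd
  have hni : n i ≠ 0 := fun h0 => hi (by rw [topForms, h0, map_zero])
  have hdeg : (n i).totalDegree = k :=
    (hk i).antisymm (not_lt.mp fun hlt => hi (homogeneousComponent_eq_zero _ _ hlt))
  rw [h.boundedSyz_eq_koszulSyz hk, ← hdeg]
  exact finrank_koszulSyz (fun _ => h.isUnit_of_dvd) hni (fun j => hdeg ▸ hk j) l

end Dimension

section LinearSystem

variable {σ R : Type*} [CommRing R]

/-- The linear combinations of a triple of polynomials whose coefficients have degree less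
than `m`. -/
noncomputable def boundedCombinations (n : Fin 3 → MvPolynomial σ R) (m : ℕ) :
    Submodule R (MvPolynomial σ R) :=
  (fieldDegreeLT σ R m).map ((Fintype.linearCombination (MvPolynomial σ R) n).restrictScalars R)

/-- The matrix of `q ↦ ∑ i, q i * n i` with respect to the monomials of degree at most `l` in the
components of `q` and the monomials of degree at most `d` in the result. -/
noncomputable def macaulayMatrix (n : Fin 3 → MvPolynomial (Fin 2) R) (d l : ℕ) :
    Matrix (exponents d) (Fin 3 × exponents l) R :=
  Matrix.of fun e c => coeff e.1 (monomial c.2.1 1 * n c.1)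

/-- The coefficients of a polynomial at the monomials of degree at most `d`. -/
noncomputable def coeffsLE (R : Type*) [CommRing R] (d : ℕ) :
    MvPolynomial (Fin 2) R →ₗ[R] exponents d → R :=
  LinearMap.pi fun e => lcoeff R e.1

variable {n : Fin 3 → MvPolynomial σ R} {k : ℕ}

theorem boundedSyz_eq_inf_ker (n : Fin 3 → MvPolynomial σ R) (l : ℕ) :
    boundedSyz n l = fieldDegreeLT σ R (l + 1)
      ⊓ LinearMap.ker ((Fintype.linearCombination (MvPolynomial σ R) n).restrictScalars R) := by
  ext q
  rw [mem_boundedSyz, and_comm]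
  rfl

theorem boundedCombinations_le (hk : ∀ i, (n i).totalDegree ≤ k) (l : ℕ) :
    boundedCombinations n (l + 1) ≤ totalDegreeLT σ R (k + l + 1) := by
  rintro _ ⟨q, hq, rfl⟩
  refine Submodule.sum_mem _ fun i _ => mul_mem_totalDegreeLT ?_ (hk i)
  rw [add_assoc, Nat.add_sub_cancel_left]
  exact mem_fieldDegreeLT.mp hq i

theorem topForm_mem_span_of_mem_boundedCombinations (hk : ∀ i, (n i).totalDegree ≤ k) {l : ℕ}
    {p : MvPolynomial σ R} (hp : p ∈ boundedCombinations n (l + 1)) :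
    homogeneousComponent (l + k) p ∈ Ideal.span (Set.range (topForms k n)) := by
  obtain ⟨q, hq, rfl⟩ := hp
  refine Ideal.mem_span_range_iff_exists_fun.mpr ⟨topForms l q, ?_⟩
  change _ = homogeneousComponent (l + k) (∑ i, q i * n i)
  rw [map_sum]
  exact Finset.sum_congr rfl fun i _ =>
    (homogeneousComponent_add_mul (mem_fieldDegreeLT.mp hq i) (hk i)).symm

end LinearSystem

section Rank

variable {K : Type*} [Field K] {n : Fin 3 → MvPolynomial (Fin 2) K} {k : ℕ}

theorem finrank_boundedCombinations_add (n : Fin 3 → MvPolynomial (Fin 2) K) (l : ℕ) :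
    Module.finrank K (boundedCombinations n (l + 1)) + Module.finrank K (boundedSyz n l)
      = 3 * (l + 2).choose 2 := by
  rw [boundedSyz_eq_inf_ker, boundedCombinations, finrank_map_add_finrank_inf_ker,
    finrank_fieldDegreeLT]

theorem fieldDegreeLT_succ_eq_span (l : ℕ) :
    fieldDegreeLT (Fin 2) K (l + 1) = Submodule.span K (Set.range
      fun c : Fin 3 × exponents l => Pi.single c.1 (monomial c.2.1 1)) := by
  rw [fieldDegreeLT, ← Submodule.iSup_map_single]
  simp only [totalDegreeLT_succ_eq_restrictSupport_exponents, restrictSupport_eq_span,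
    Submodule.map_span, ← Submodule.span_iUnion]
  congr 1
  ext q
  simp

theorem boundedCombinations_succ_eq_span (n : Fin 3 → MvPolynomial (Fin 2) K) (l : ℕ) :
    boundedCombinations n (l + 1) = Submodule.span K (Set.range
      fun c : Fin 3 × exponents l => monomial c.2.1 1 * n c.1) := by
  rw [boundedCombinations, fieldDegreeLT_succ_eq_span, Submodule.map_span, ← Set.range_comp]
  congr 2
  funext c
  exact Fintype.linearCombination_apply_single _ _ _ _

theorem totalDegreeLT_inf_ker_coeffsLE (d : ℕ) :
    totalDegreeLT (Fin 2) K (d + 1) ⊓ LinearMap.ker (coeffsLE K d) = ⊥ := by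
  refine (Submodule.eq_bot_iff _).mpr fun p ⟨hp, hker⟩ => MvPolynomial.ext _ _ fun e => ?_
  by_contra he
  have := mem_totalDegreeLT.mp hp e he
  rw [Nat.lt_succ_iff, Finsupp.degree_eq_sum, Fin.sum_univ_two, ← mem_exponents] at this
  exact he (congrFun hker ⟨e, this⟩)

theorem rank_macaulayMatrix (hk : ∀ i, (n i).totalDegree ≤ k) (l : ℕ) :
    (macaulayMatrix n (k + l) l).rank = Module.finrank K (boundedCombinations n (l + 1)) := by
  have trivial_ker : boundedCombinations n (l + 1) ⊓ LinearMap.ker (coeffsLE K (k + l)) = ⊥ :=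
    eq_bot_mono (inf_le_inf_right _ (boundedCombinations_le hk l))
      (totalDegreeLT_inf_ker_coeffsLE (k + l))
  have : FiniteDimensional K (boundedCombinations n (l + 1)) :=
    Submodule.finiteDimensional_of_le (boundedCombinations_le hk l)
  rw [← finrank_map_add_finrank_inf_ker (coeffsLE K (k + l)), trivial_ker, finrank_bot, add_zero,
    boundedCombinations_succ_eq_span, Submodule.map_span, ← Set.range_comp,
    Matrix.rank_eq_finrank_span_cols]
  rfl

theorem rank_macaulayMatrix_add_finrank_boundedSyz (hk : ∀ i, (n i).totalDegree ≤ k) (l : ℕ) :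
    (macaulayMatrix n (k + l) l).rank + Module.finrank K (boundedSyz n l)
      = 3 * (l + 2).choose 2 := by
  rw [rank_macaulayMatrix hk, finrank_boundedCombinations_add]

theorem noBasePoint_of_boundedCombinations_eq {σ L : Type*} [Field L] [Algebra K L]
    [IsAlgClosed L] [Finite σ] {n : Fin 3 → MvPolynomial σ K}
    (hk : ∀ i, (n i).totalDegree ≤ k) {l : ℕ}
    (h : boundedCombinations n (l + 1) = totalDegreeLT σ K (k + l + 1)) : NoBasePoint L k n := by
  refine ⟨span_eq_top_iff_no_zero.mp ((Ideal.eq_top_iff_one _).mpr ?_),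
    noProjectiveZero_iff_exists_X_pow_mem_span.mpr fun j => ⟨l + k, ?_⟩⟩
  · have one_mem : (1 : MvPolynomial σ K) ∈ boundedCombinations n (l + 1) := by
      rw [h, mem_totalDegreeLT_succ, totalDegree_one]
      exact Nat.zero_le _
    obtain ⟨q, -, hq⟩ := one_mem
    exact Ideal.mem_span_range_iff_exists_fun.mpr ⟨q, hq⟩
  · have X_pow_mem : (X j : MvPolynomial σ K) ^ (l + k) ∈ boundedCombinations n (l + 1) := by
      rw [h, mem_totalDegreeLT_succ, totalDegree_X_pow, add_comm]
    rw [← homogeneousComponent_eq_self (isHomogeneous_X_pow j (l + k))]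
    exact topForm_mem_span_of_mem_boundedCombinations hk X_pow_mem

theorem noBasePoint_of_rank_macaulayMatrix_eq {L : Type*} [Field L] [Algebra K L] [IsAlgClosed L]
    (hk : ∀ i, (n i).totalDegree ≤ k) {l : ℕ}
    (h : (macaulayMatrix n (k + l) l).rank = Fintype.card (exponents (k + l))) :
    NoBasePoint L k n := by
  refine noBasePoint_of_boundedCombinations_eq hk (l := l) ?_
  refine Submodule.eq_of_le_of_finrank_eq (boundedCombinations_le hk l) ?_
  rw [← rank_macaulayMatrix hk, h, finrank_totalDegreeLT, Fintype.card_coe, card_exponents]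

theorem koszulDim_eq {k l : ℕ} (h : 2 * k ≤ l + 2) :
    koszulDim k l = 3 * ((l + 2).choose 2 : ℤ) - ((k + l + 2).choose 2 : ℤ) := by
  obtain ⟨m, hm⟩ := Nat.exists_eq_add_of_le h
  have thirdDifference : 3 * ((k + m).choose 2 : ℚ) - (m.choose 2 : ℚ)
      = 3 * ((2 * k + m).choose 2 : ℚ) - ((3 * k + m).choose 2 : ℚ) := by
    simp only [Nat.cast_choose_two]
    push_cast
    ring
  rw [koszulDim, show k + l + 2 = 3 * k + m by omega, hm, show 2 * k + m - k = k + m by omega,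
    Nat.add_sub_cancel_left]
  exact_mod_cast thirdDifference

theorem rank_macaulayMatrix_eq_card_iff (hk : ∀ i, (n i).totalDegree ≤ k) {l : ℕ}
    (hl : 2 * k ≤ l + 2) :
    (macaulayMatrix n (k + l) l).rank = Fintype.card (exponents (k + l))
      ↔ (Module.finrank K (boundedSyz n l) : ℤ) = koszulDim k l := by
  have := rank_macaulayMatrix_add_finrank_boundedSyz hk l
  rw [koszulDim_eq hl, Fintype.card_coe, card_exponents]
  omega

theorem finrank_boundedSyz_eq_koszulDim_iff {L : Type*} [Field L] [Algebra K L] [IsAlgClosed L]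
    (hk : ∀ i, (n i).totalDegree ≤ k) {l : ℕ} (hl : 2 * k ≤ l + 2) :
    (Module.finrank K (boundedSyz n l) : ℤ) = koszulDim k l ↔ NoBasePoint L k n :=
  ⟨fun h => noBasePoint_of_rank_macaulayMatrix_eq hk
      ((rank_macaulayMatrix_eq_card_iff hk hl).mpr h),
    fun h => h.finrank_boundedSyz hk l⟩

end Rank

section Homogeneous

variable {R : Type*} [CommSemiring R]

theorem eval_smul_of_isHomogeneous {σ : Type*} [Finite σ] {d : ℕ} {Q : MvPolynomial σ R}
    (hQ : Q.IsHomogeneous d) (c : R) (x : σ → R) : eval (c • x) Q = c ^ d * eval x Q := by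
  have := Fintype.ofFinite σ
  rw [eval_eq', eval_eq', Finset.mul_sum]
  refine Finset.sum_congr rfl fun e he => ?_
  have degree_eq : ∑ i, e i = d := by
    rw [← Finsupp.degree_eq_sum]
    exact (hQ.degree_eq_sum_deg_support he).symm
  simp only [← degree_eq, ← Finset.prod_pow_eq_pow_sum, Pi.smul_apply, smul_eq_mul, mul_pow,
    Finset.prod_mul_distrib]
  ring

/-- The dehomogenization `Q(u, v, 1)` of a polynomial `Q(u, v, w)`. -/
noncomputable def dehomogenize (R : Type*) [CommSemiring R] :
    MvPolynomial (Fin 3) R →ₐ[R] MvPolynomial (Fin 2) R :=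
  aeval ![X 0, X 1, 1]

theorem eval_dehomogenize (y : Fin 2 → R) (Q : MvPolynomial (Fin 3) R) :
    eval y (dehomogenize R Q) = eval ![y 0, y 1, 1] Q := by
  have : (aeval y).comp (dehomogenize R) = aeval (R := R) ![y 0, y 1, 1] := by
    ext i
    fin_cases i <;> simp [dehomogenize]
  exact DFunLike.congr_fun this Q

theorem totalDegree_dehomogenize_le (Q : MvPolynomial (Fin 3) R) :
    (dehomogenize R Q).totalDegree ≤ Q.totalDegree := by
  rw [dehomogenize, aeval_def, eval₂_eq']
  refine totalDegree_finsetSum_le fun e he => ?_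
  have he : e.degree ≤ Q.totalDegree := le_totalDegree he
  rw [Finsupp.degree_eq_sum, Fin.sum_univ_three] at he
  rw [algebraMap_eq, Fin.prod_univ_three]
  simp only [Matrix.cons_val, one_pow, mul_one]
  have hC := totalDegree_mul (C (Q.coeff e)) (X 0 ^ e 0 * X 1 ^ e 1 : MvPolynomial (Fin 2) R)
  have hX : (X 0 ^ e 0 * X 1 ^ e 1 : MvPolynomial (Fin 2) R).totalDegree ≤ e 0 + e 1 :=
    ((isHomogeneous_X_pow _ _).mul (isHomogeneous_X_pow _ _)).totalDegree_le
  rw [totalDegree_C] at hC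
  omega

theorem eval_eq_pow_mul_eval_dehomogenize {K : Type*} [Field K] {d : ℕ} {Q : MvPolynomial (Fin 3) K}
    (hQ : Q.IsHomogeneous d) {x : Fin 3 → K} (hx : x 2 ≠ 0) :
    eval x Q = x 2 ^ d * eval ![x 0 / x 2, x 1 / x 2] (dehomogenize K Q) := by
  rw [eval_dehomogenize, ← eval_smul_of_isHomogeneous hQ]
  congr 2
  ext i
  fin_cases i <;> simp [mul_div_cancel₀, hx]

theorem eq_zero_of_dehomogenize_eq_zero {K : Type*} [Field K] [Infinite K] {d : ℕ}
    {Q : MvPolynomial (Fin 3) K} (hQ : Q.IsHomogeneous d) (h : dehomogenize K Q = 0) : Q = 0 := by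
  have mul_X_eq_zero : Q * X 2 = 0 := by
    refine MvPolynomial.funext fun x => ?_
    rcases eq_or_ne (x 2) 0 with hx | hx
    · simp [hx]
    · simp [eval_eq_pow_mul_eval_dehomogenize hQ hx, h]
  exact (mul_eq_zero.mp mul_X_eq_zero).resolve_right (X_ne_zero _)

end Homogeneous

section Homogenization

variable {K : Type*} (L : Type*) [CommSemiring K] [CommSemiring L] [Algebra K L]

/-- The homogenization `w ^ k * p (u / w, v / w)` of a polynomial `p` with `deg p ≤ k`, with
coefficients in an extension `L` of the coefficient field. -/
noncomputable def homogenize (k : ℕ) (p : MvPolynomial (Fin 2) K) : MvPolynomial (Fin 3) L :=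
  ∑ m ∈ p.support,
    C (algebraMap K L (p.coeff m)) * (X 0 ^ m 0 * X 1 ^ m 1 * X 2 ^ (k - (m 0 + m 1)))

variable {L} {k : ℕ} {p : MvPolynomial (Fin 2) K}

theorem exponent_add_le_totalDegree {m : Fin 2 →₀ ℕ} (hm : m ∈ p.support) :
    m 0 + m 1 ≤ p.totalDegree := by
  rw [← Fin.sum_univ_two, ← Finsupp.degree_eq_sum]
  exact le_totalDegree hm

theorem homogenize_isHomogeneous (hp : p.totalDegree ≤ k) :
    (homogenize L k p).IsHomogeneous k := by
  refine IsHomogeneous.sum _ _ _ fun m hm => ?_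
  have hmk := (exponent_add_le_totalDegree hm).trans hp
  rw [show k = 0 + (m 0 + m 1 + (k - (m 0 + m 1))) by omega]
  refine (isHomogeneous_C _ _).mul
    (((isHomogeneous_X_pow _ _).mul (isHomogeneous_X_pow _ _)).mul ?_)
  rw [← show k = 0 + (m 0 + m 1 + (k - (m 0 + m 1))) by omega]
  exact isHomogeneous_X_pow _ _

theorem dehomogenize_homogenize (k : ℕ) (p : MvPolynomial (Fin 2) K) :
    dehomogenize L (homogenize L k p) = map (algebraMap K L) p := by
  conv_rhs => rw [← support_sum_monomial_coeff p]
  rw [homogenize, map_sum, map_sum]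
  refine Finset.sum_congr rfl fun m _ => ?_
  rw [map_monomial, monomial_eq, Finsupp.prod_fintype _ _ fun _ => pow_zero _]
  simp [dehomogenize, Fin.prod_univ_two]

theorem aeval_homogenize_of_eq_zero (hp : p.totalDegree ≤ k) {x : Fin 3 → L} (hx : x 2 = 0) :
    aeval x (homogenize L k p) = aeval ![x 0, x 1] (homogeneousComponent k p) := by
  rw [homogenize, homogeneousComponent_apply, map_sum, map_sum, Finset.sum_filter]
  refine Finset.sum_congr rfl fun m hm => ?_
  have hmk := (exponent_add_le_totalDegree hm).trans hp
  rw [Finsupp.degree_eq_sum, Fin.sum_univ_two]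
  split_ifs with h
  · simp [h, aeval_monomial, Finsupp.prod_fintype, Fin.prod_univ_two]
  · have : k - (m 0 + m 1) ≠ 0 := by omega
    simp [hx, this]

end Homogenization

section ProjectiveZeros

variable {K L : Type*} [Field K] [Field L] [Algebra K L] {k : ℕ} {p : MvPolynomial (Fin 2) K}
  {n : Fin 3 → MvPolynomial (Fin 2) K}

theorem aeval_homogenize_of_ne_zero (hp : p.totalDegree ≤ k) {x : Fin 3 → L} (hx : x 2 ≠ 0) :
    aeval x (homogenize L k p) = x 2 ^ k * aeval ![x 0 / x 2, x 1 / x 2] p := by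
  rw [aeval_eq_eval, eval_eq_pow_mul_eval_dehomogenize (homogenize_isHomogeneous hp) hx,
    dehomogenize_homogenize, eval_map, ← aeval_def]

theorem NoProjectiveZero.noBasePoint_of_homogenize (hk : ∀ i, (n i).totalDegree ≤ k)
    (h : NoProjectiveZero L fun i => homogenize L k (n i)) : NoBasePoint L k n := by
  have eta : ∀ y : Fin 2 → L, ![y 0, y 1] = y := fun y => List.ofFn_inj.mp rfl
  refine ⟨fun ⟨y, hy⟩ => h ⟨![y 0, y 1, 1], fun h0 => ?_, fun i => ?_⟩,
    fun ⟨y, hy0, hy⟩ => h ⟨![y 0, y 1, 0], fun h0 => hy0 ?_, fun i => ?_⟩⟩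
  · simpa using congrFun h0 2
  · rw [aeval_homogenize_of_ne_zero (hk i) (by simp)]
    simpa [eta] using hy i
  · rw [← eta y, show y 0 = 0 from congrFun h0 0, show y 1 = 0 from congrFun h0 1]
    simp
  · rw [aeval_homogenize_of_eq_zero (hk i) (by simp)]
    simpa [eta, topForms] using hy i

theorem NoBasePoint.noProjectiveZero_homogenize (hk : ∀ i, (n i).totalDegree ≤ k)
    (h : NoBasePoint L k n) : NoProjectiveZero L fun i => homogenize L k (n i) := by
  rintro ⟨x, hx0, hx⟩
  rcases eq_or_ne (x 2) 0 with hx2 | hx2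
  · refine h.2 ⟨![x 0, x 1], fun h0 => hx0 ?_, fun i => ?_⟩
    · ext j
      fin_cases j
      exacts [congrFun h0 0, congrFun h0 1, hx2]
    · exact (aeval_homogenize_of_eq_zero (hk i) hx2).symm.trans (hx i)
  · refine h.1 ⟨![x 0 / x 2, x 1 / x 2], fun i => ?_⟩
    have := hx i
    rw [aeval_homogenize_of_ne_zero (hk i) hx2] at this
    exact (mul_eq_zero.mp this).resolve_left (pow_ne_zero k hx2)

theorem noProjectiveZero_homogenize_iff (hk : ∀ i, (n i).totalDegree ≤ k) :
    NoProjectiveZero L (fun i => homogenize L k (n i)) ↔ NoBasePoint L k n :=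
  ⟨fun h => h.noBasePoint_of_homogenize hk, fun h => h.noProjectiveZero_homogenize hk⟩

end ProjectiveZeros

section HilbertFunction

variable {R L : Type*} [CommRing R] [Field L] [Algebra R L]

/-- The degree `l` piece of the graded module `Syz(N)` of a triple of forms: the syzygies all of
whose components are homogeneous of degree `l`. -/
noncomputable def gradedSyz (N : Fin 3 → MvPolynomial (Fin 3) R) (l : ℕ) :
    Submodule R (Fin 3 → MvPolynomial (Fin 3) R) :=
  (syz N).restrictScalars R ⊓ Submodule.pi Set.univ fun _ => homogeneousSubmodule (Fin 3) R l

variable {k : ℕ} {n : Fin 3 → MvPolynomial (Fin 2) R}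

theorem mem_gradedSyz {N Q : Fin 3 → MvPolynomial (Fin 3) R} {l : ℕ} :
    Q ∈ gradedSyz N l ↔ ∑ i, Q i * N i = 0 ∧ ∀ i, (Q i).IsHomogeneous l :=
  and_congr Iff.rfl (by simp)

theorem dehomogenize_mem_boundedSyz {l : ℕ} {Q : Fin 3 → MvPolynomial (Fin 3) L}
    (hQ : Q ∈ gradedSyz (fun i => homogenize L k (n i)) l) :
    (fun i => dehomogenize L (Q i)) ∈ boundedSyz (fun i => map (algebraMap R L) (n i)) l := by
  obtain ⟨hQ0, hQl⟩ := mem_gradedSyz.mp hQ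
  refine mem_boundedSyz.mpr ⟨?_, mem_fieldDegreeLT.mpr fun i => mem_totalDegreeLT_succ.mpr
    ((totalDegree_dehomogenize_le (Q i)).trans (hQl i).totalDegree_le)⟩
  simpa only [map_sum, map_mul, dehomogenize_homogenize, map_zero]
    using congrArg (dehomogenize L) hQ0

theorem homogenize_mem_gradedSyz [Infinite L] (hk : ∀ i, (n i).totalDegree ≤ k) {l : ℕ}
    {q : Fin 3 → MvPolynomial (Fin 2) L}
    (hq : q ∈ boundedSyz (fun i => map (algebraMap R L) (n i)) l) :
    (fun i => homogenize L l (q i)) ∈ gradedSyz (fun i => homogenize L k (n i)) l := by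
  obtain ⟨hq0, hql⟩ := mem_boundedSyz.mp hq
  have homogeneous : ∀ i, (homogenize L l (q i)).IsHomogeneous l := fun i =>
    homogenize_isHomogeneous (mem_totalDegreeLT_succ.mp (mem_fieldDegreeLT.mp hql i))
  refine mem_gradedSyz.mpr ⟨eq_zero_of_dehomogenize_eq_zero (d := l + k) ?_ ?_, homogeneous⟩
  · exact IsHomogeneous.sum _ _ _ fun i _ =>
      (homogeneous i).mul (homogenize_isHomogeneous (hk i))
  · simpa only [map_sum, map_mul, dehomogenize_homogenize, Algebra.algebraMap_self, map_id]
      using hq0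

theorem map_dehomogenize_gradedSyz [Infinite L] (hk : ∀ i, (n i).totalDegree ≤ k) (l : ℕ) :
    (gradedSyz (fun i => homogenize L k (n i)) l).map
        ((dehomogenize L).toLinearMap.compLeft (Fin 3))
      = boundedSyz (fun i => map (algebraMap R L) (n i)) l := by
  refine le_antisymm ?_ fun q hq =>
    ⟨fun i => homogenize L l (q i), homogenize_mem_gradedSyz hk hq, funext fun i => ?_⟩
  · rintro _ ⟨Q, hQ, rfl⟩
    exact dehomogenize_mem_boundedSyz hQ
  · change dehomogenize L (homogenize L l (q i)) = q i
    rw [dehomogenize_homogenize, Algebra.algebraMap_self, map_id]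

theorem finrank_gradedSyz_homogenize [Infinite L] (hk : ∀ i, (n i).totalDegree ≤ k) (l : ℕ) :
    Module.finrank L (gradedSyz (fun i => homogenize L k (n i)) l)
      = Module.finrank L (boundedSyz (fun i => map (algebraMap R L) (n i)) l) := by
  rw [← map_dehomogenize_gradedSyz hk]
  set f := (dehomogenize L).toLinearMap.compLeft (Fin 3)
  set G := gradedSyz (fun i => homogenize L k (n i)) l
  have injective : Function.Injective (f.domRestrict G) := by
    refine (injective_iff_map_eq_zero _).mpr fun Q hQ => Subtype.ext (funext fun i => ?_)
    exact eq_zero_of_dehomogenize_eq_zero ((mem_gradedSyz.mp Q.2).2 i) (congrFun hQ i)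
  rw [← LinearMap.range_domRestrict, LinearMap.finrank_range_of_inj injective]

end HilbertFunction

section BaseChange

variable {K L : Type*} [Field K] [Field L] [Algebra K L]

theorem span_range_algebraMap_comp {ι α : Type*} (v : ι → α → K) :
    Submodule.span L (Set.range fun i => algebraMap K L ∘ v i)
      = Submodule.span L ((Submodule.span K (Set.range v)).map (Pi.algebraMap α K L)) := by
  rw [Submodule.map_span, ← Set.range_comp, Submodule.span_span_of_tower]
  rfl

theorem rank_map_algebraMap {α β : Type*} [Finite α] [Fintype β] (M : Matrix α β K) :
    (M.map (algebraMap K L)).rank = M.rank := by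
  obtain ⟨κ, a, injective, span_eq, independent⟩ := exists_linearIndependent' K M.col
  have := Finite.of_injective a injective
  have := Fintype.ofFinite κ
  have independent_map : LinearIndependent L fun c => algebraMap K L ∘ (M.col ∘ a) c :=
    linearIndependent_algebraMap_comp_iff.mpr independent
  calc (M.map (algebraMap K L)).rank
      = Module.finrank L (Submodule.span L
          (Set.range fun j => algebraMap K L ∘ M.col j)) := Matrix.rank_eq_finrank_span_cols _
    _ = Module.finrank L (Submodule.span L
          (Set.range fun c => algebraMap K L ∘ (M.col ∘ a) c)) := by
        rw [span_range_algebraMap_comp, ← span_eq, ← span_range_algebraMap_comp]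
    _ = M.rank := by
        rw [finrank_span_eq_card independent_map, Matrix.rank_eq_finrank_span_cols, ← span_eq,
          finrank_span_eq_card independent]

theorem macaulayMatrix_map (n : Fin 3 → MvPolynomial (Fin 2) K) (d l : ℕ) :
    macaulayMatrix (fun i => map (algebraMap K L) (n i)) d l
      = (macaulayMatrix n d l).map (algebraMap K L) := by
  ext e c
  simp only [macaulayMatrix, Matrix.map_apply, Matrix.of_apply]
  rw [← coeff_map, map_mul, map_monomial, map_one (algebraMap K L)]

theorem finrank_boundedSyz_map {n : Fin 3 → MvPolynomial (Fin 2) K} (l : ℕ) :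
    Module.finrank L (boundedSyz (fun i => map (algebraMap K L) (n i)) l)
      = Module.finrank K (boundedSyz n l) := by
  obtain ⟨k, hk⟩ := Finite.bddAbove_range fun i => (n i).totalDegree
  have hk : ∀ i, (n i).totalDegree ≤ k := fun i => hk ⟨i, rfl⟩
  have hkL : ∀ i, (map (algebraMap K L) (n i)).totalDegree ≤ k := fun i =>
    (Finset.sup_mono (support_map_subset _ _)).trans (hk i)
  have finrank_K := rank_macaulayMatrix_add_finrank_boundedSyz hk l
  have finrank_L := rank_macaulayMatrix_add_finrank_boundedSyz hkL l
  rw [macaulayMatrix_map, rank_map_algebraMap] at finrank_L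
  omega

end BaseChange

theorem finrank_gradedSyz_homogenize_eq_finrank_boundedSyz {K L : Type*} [Field K] [Field L]
    [Algebra K L] [Infinite L] {n : Fin 3 → MvPolynomial (Fin 2) K} {k : ℕ}
    (hk : ∀ i, (n i).totalDegree ≤ k) (l : ℕ) :
    Module.finrank L (gradedSyz (fun i => homogenize L k (n i)) l)
      = Module.finrank K (boundedSyz n l) := by
  rw [finrank_gradedSyz_homogenize hk, finrank_boundedSyz_map]

theorem mainTheorem5_general {K : Type*} (L : Type*) [Field K] [Field L] [Algebra K L]
    [IsAlgClosed L] (n : Fin 3 → MvPolynomial (Fin 2) K) (k : ℕ)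
    (hk : ∀ i, (n i).totalDegree ≤ k) :
    (∀ l : ℕ, koszulDim k l
      ≤ (Module.finrank L (gradedSyz (fun i => homogenize L k (n i)) l) : ℤ)) ∧
    ((∀ l : ℕ, (Module.finrank L (gradedSyz (fun i => homogenize L k (n i)) l) : ℤ)
        = koszulDim k l)
      ↔ NoProjectiveZero L (fun i => homogenize L k (n i))) ∧
    (∀ l : ℕ, 2 * k ≤ l + 2 →
      ((Module.finrank L (gradedSyz (fun i => homogenize L k (n i)) l) : ℤ) = koszulDim k l
        ↔ NoProjectiveZero L (fun i => homogenize L k (n i)))) ∧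
    (NoProjectiveZero L (fun i => homogenize L k (n i)) ↔ NoBasePoint L k n) ∧
    (∀ l : ℕ, Module.finrank K (boundedSyz n l)
      = Module.finrank L (gradedSyz (fun i => homogenize L k (n i)) l)) ∧
    (∀ l : ℕ, (macaulayMatrix n (k + l) l).rank = Fintype.card (exponents (k + l))
      → NoBasePoint L k n) ∧
    (∀ l : ℕ, 2 * k ≤ l + 2 →
      ((macaulayMatrix n (k + l) l).rank = Fintype.card (exponents (k + l))
        ↔ NoBasePoint L k n)) ∧
    (NoBasePoint L k n → ∀ l : ℕ, 2 * k ≤ l + 2 →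
      (Module.finrank K (boundedSyz n l) : ℤ)
        = 3 * ((l + 2).choose 2 : ℤ) - ((k + l + 2).choose 2 : ℤ)) := by
  have finrank_eq := finrank_gradedSyz_homogenize_eq_finrank_boundedSyz (L := L) hk
  have finrank_iff : ∀ l, 2 * k ≤ l + 2 →
      ((Module.finrank K (boundedSyz n l) : ℤ) = koszulDim k l ↔ NoBasePoint L k n) :=
    fun l hl => finrank_boundedSyz_eq_koszulDim_iff hk hl
  simp only [noProjectiveZero_homogenize_iff hk, finrank_eq]
  refine ⟨koszulDim_le_finrank_boundedSyz hk, ⟨fun h => ?_, fun h l => h.finrank_boundedSyz hk l⟩,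
    finrank_iff, trivial, fun _ => trivial, fun l => noBasePoint_of_rank_macaulayMatrix_eq hk,
    fun l hl => ?_, fun h l hl => ?_⟩
  · exact (finrank_iff (2 * k) (by omega)).mp (h _)
  · rw [rank_macaulayMatrix_eq_card_iff hk hl, finrank_iff l hl]
  · rw [h.finrank_boundedSyz hk, koszulDim_eq hl]

theorem mainTheorem5 (n : Fin 3 → MvPolynomial (Fin 2) ℝ) (k : ℕ) (hk : fieldDegree n = k)
    (hn : CoprimeComponents n) :
    -- the lower bound for the Hilbert function; `Nat.choose (l + 2 - a) 2` is the dimension of the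
    -- forms of degree `l - a` in three variables, and is `0` for `l < a`
    (∀ l : ℕ, 3 * (Nat.choose (l + 2 - k) 2 : ℤ) - (Nat.choose (l + 2 - 2 * k) 2 : ℤ)
      ≤ (hilbertSyz (homogenizeField n) l : ℤ)) ∧
    -- equality in all degrees
    ((∀ l : ℕ, (hilbertSyz (homogenizeField n) l : ℤ)
        = 3 * (Nat.choose (l + 2 - k) 2 : ℤ) - (Nat.choose (l + 2 - 2 * k) 2 : ℤ))
      ↔ HomBasepointFree (homogenizeField n)) ∧
    -- equality in one degree `l ≥ 2 k - 2`
    (∀ l : ℕ, 2 * k ≤ l + 2 →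
      ((hilbertSyz (homogenizeField n) l : ℤ)
          = 3 * (Nat.choose (l + 2 - k) 2 : ℤ) - (Nat.choose (l + 2 - 2 * k) 2 : ℤ)
        ↔ HomBasepointFree (homogenizeField n))) ∧
    -- the affine reformulation
    (HomBasepointFree (homogenizeField n) ↔ BasepointFree n) ∧
    (∀ l : ℕ, Module.finrank ℝ (orthogonalFields n l) = hilbertSyz (homogenizeField n) l) ∧
    (∀ l : ℕ, FullRank n l → BasepointFree n) ∧
    (∀ l : ℕ, 2 * k ≤ l + 2 → (FullRank n l ↔ BasepointFree n)) ∧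
    (BasepointFree n → ∀ l : ℕ, 2 * k ≤ l + 2 →
      (Module.finrank ℝ (orthogonalFields n l) : ℤ)
        = 3 * (Nat.choose (l + 2) 2 : ℤ) - (Nat.choose (k + l + 2) 2 : ℤ)) := by
  subst hk
  exact mainTheorem5_general ℂ n _ fun i =>
    Finset.le_sup (f := fun i => (n i).totalDegree) (Finset.mem_univ i)
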